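/- Let $G$ be a finitely generated group and let $H_1,\dots,H_n$ be finitely generated subgroups of $G$. Write $X^*=G\setminus X$ for $X\subseteq G$. For a subgroup $H\le G$, a subset of $G$ is $H$-finite if it is contained in a union of finitely many cosets $Hg$. A subset $X\subseteq G$ is $H$-almost invariant if $hX=X$ for all $h\in H$ and, for every $g\in G$, the subsets $(H\backslash X)g$ and $H\backslash X$ of $H\backslash G$ have finite symmetric difference; it is nontrivial if $H\backslash X$ and $H\backslash X^*$ are both infinite. An $H$-almost invariant set $X$ and a $K$-almost invariant set $Z$ are equivalent if their symmetric difference is $H$-finite. The corners of a pair $(U,V)$ of subsets of $G$ are $U\cap V$, $U^*\cap V$, $U\cap V^*$, $U^*\cap V^*$. If $U$ is $L$-almost invariant, then $U$ and $V$ cross if no corner is $L$-finite; they are nested if some corner is empty; and $U\le V$ (almost inclusion) means that $U\cap V^*$ is empty or is the only $L$-finite one among the four corners. For $i=1,\dots,n$ let $X_i$ be a nontrivial $H_i$-almost invariant subset of $G$. Then there are subgroups $K_1,\dots,K_n$ of $G$ and nontrivial $K_i$-almost invariant subsets $Z_i$ of $G$ such that each $Z_i$ is equivalent to $X_i$ and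 the family $Z_1,\dots,Z_n$ is in very good position: any two elements of $E(Z)=\{gZ_i,\,gZ_i^* : g\in G,\ 1\le i\le n\}$ either cross or are nested, where $gZ_i$ and $gZ_i^*$ are regarded as almost invariant over $gK_ig^{-1}$. Consequently, for all $U,V\in E(Z)$, one has $U\le V$ if and only if $U\subseteq V$. -/

import Mathlib

open scoped Pointwise

namespace AlmostInv

variable {G : Type*} [Group G]

/-- The set `H\G` of cosets `Hg`, the quotient of `G` by left multiplication by `H`. -/
abbrev Cosets (H : Subgroup G) : Type _ := Quotient (QuotientGroup.rightRel H)

/-- The image `H\X` in `H\G` of a subset `X` of `G`. -/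
def proj (H : Subgroup G) (X : Set G) : Set (Cosets H) :=
  (fun x => (Quotient.mk (QuotientGroup.rightRel H) x : Cosets H)) '' X

/-- The right action of `G` on `H\G`: the element `g` sends `Hx` to `Hxg`. -/
def cosetMulRight (H : Subgroup G) (g : G) : Cosets H → Cosets H :=
  Quotient.map (fun x => x * g) (by
    intro a b hab
    have h : b * a⁻¹ ∈ H := QuotientGroup.rightRel_apply.mp hab
    exact QuotientGroup.rightRel_apply.mpr (by simpa [mul_assoc] using h))

/-- `X` is `H`-almost invariant: `hX = X` for all `h ∈ H`, and `P = H\X` is an almost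
invariant subset of `H\G`, i.e. `Pg` and `P` have finite symmetric difference for all `g`. -/
def IsAlmostInvariant (H : Subgroup G) (X : Set G) : Prop :=
  (∀ h ∈ H, h • X = X) ∧
    ∀ g : G, (symmDiff (cosetMulRight H g '' proj H X) (proj H X)).Finite

/-- `X` is a nontrivial `H`-almost invariant set: moreover `H\X` and `H\Xᶜ` are infinite. -/
def IsNontrivialAlmostInvariant (H : Subgroup G) (X : Set G) : Prop :=
  IsAlmostInvariant H X ∧ (proj H X).Infinite ∧ (proj H Xᶜ).Infinite

/-- `W` is `H`-finite: it is contained in the union of finitely many cosets `Hg`. -/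
def HFinite (H : Subgroup G) (W : Set G) : Prop :=
  ∃ F : Finset G, W ⊆ (H : Set G) * (F : Set G)

/-- The `H`-almost invariant set `X` and the `K`-almost invariant set `Y` are equivalent:
their symmetric difference is `H`-finite. -/
def Equivalent (H : Subgroup G) (X : Set G) (K : Subgroup G) (Y : Set G) : Prop :=
  IsAlmostInvariant H X ∧ IsAlmostInvariant K Y ∧ HFinite H (symmDiff X Y)

/-- `V` crosses the `L`-almost invariant set `U`: none of the four corners is `L`-finite. -/
def Crosses (L : Subgroup G) (U V : Set G) : Prop :=
  ¬ HFinite L (U ∩ V) ∧ ¬ HFinite L (Uᶜ ∩ V) ∧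
    ¬ HFinite L (U ∩ Vᶜ) ∧ ¬ HFinite L (Uᶜ ∩ Vᶜ)

/-- `U` and `V` are nested: one of the four corners is empty. -/
def Nested (U V : Set G) : Prop :=
  U ∩ V = ∅ ∨ Uᶜ ∩ V = ∅ ∨ U ∩ Vᶜ = ∅ ∨ Uᶜ ∩ Vᶜ = ∅

/-- Almost inclusion `U ≤ V`, where `U` is an `L`-almost invariant set: `U ∩ Vᶜ` is empty or is
the only small (that is, `L`-finite) one among the four corners. -/
def AlmostLE (L : Subgroup G) (U V : Set G) : Prop :=
  U ∩ Vᶜ = ∅ ∨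
    (HFinite L (U ∩ Vᶜ) ∧ ¬ HFinite L (U ∩ V) ∧
      ¬ HFinite L (Uᶜ ∩ V) ∧ ¬ HFinite L (Uᶜ ∩ Vᶜ))

/-- `U` belongs to `E(Z) = {gZ_i, (gZ_i)ᶜ}`, and `L = gK_ig⁻¹` is the group over which `U` is
almost invariant, given that each `Z_i` is `K_i`-almost invariant. -/
def MemE {ι : Type*} (K : ι → Subgroup G) (Z : ι → Set G) (L : Subgroup G) (U : Set G) : Prop :=
  ∃ (i : ι) (g : G), L = MulAut.conj g • K i ∧ (U = g • Z i ∨ U = (g • Z i)ᶜ)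

/-- The family of `K_i`-almost invariant sets `Z_i` is in very good position: any two elements
of `E(Z)` cross or are nested. -/
def VeryGoodPosition {ι : Type*} (K : ι → Subgroup G) (Z : ι → Set G) : Prop :=
  ∀ (L M : Subgroup G) (U V : Set G), MemE K Z L U → MemE K Z M V →
    Crosses L U V ∨ Nested U V

end AlmostInv

/-!
Almost inclusion of translates, refined by comparing the sizes of the two differences of
equivalent sets, makes the set `E(X)` of translates and complements a preordered pocset, in which
two sets with a small corner are comparable after passing to complements. An ultrafilter `w` on this
pocset replaces `A` by `{g | g⁻¹ • A ∈ w}`. This commutes with translations and complements, and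
turns every relation `A ≤ B` into a genuine inclusion because `w` is upward closed; hence a small
corner of two of the new sets forces an empty corner.

The new sets are equivalent to the old ones if `w` is close to the collection of all translates
containing `1`. Here finite generation enters: outside finitely many double cosets, the translates
of `B` are nested with `A`, so those almost containing `A` without containing it miss only a finite
part of `A` modulo the stabilizer of `A`.
-/

namespace AlmostInv

variable {G : Type*} [Group G]

open MulAction (stabilizer)
open scoped symmDiff

/-- The coset `Hx` as a point of `H\G`. -/
abbrev Cosets.mk (H : Subgroup G) (x : G) : Cosets H := Quotient.mk (QuotientGroup.rightRel H) x

section Cosets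

variable {H K : Subgroup G} {X A B C : Set G} {x y : G}

theorem Cosets.mk_eq_mk_iff : Cosets.mk H x = Cosets.mk H y ↔ y * x⁻¹ ∈ H :=
  Quotient.eq.trans QuotientGroup.rightRel_apply

theorem mul_mem_iff_of_mem_stabilizer {k : G} (hk : k ∈ stabilizer G X) : k * x ∈ X ↔ x ∈ X :=
  MulAction.mem_stabilizer_set.1 hk x

theorem mk_mem_proj_iff (hX : H ≤ stabilizer G X) : Cosets.mk H x ∈ proj H X ↔ x ∈ X := by
  refine ⟨?_, Set.mem_image_of_mem _⟩
  rintro ⟨y, hy, hyx⟩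
  simpa using (mul_mem_iff_of_mem_stabilizer (hX (Cosets.mk_eq_mk_iff.1 hyx))).2 hy

theorem proj_sdiff (hB : H ≤ stabilizer G B) : proj H (A \ B) = proj H A \ proj H B := by
  ext q
  constructor
  · rintro ⟨x, ⟨hxA, hxB⟩, rfl⟩
    exact ⟨⟨x, hxA, rfl⟩, mt (mk_mem_proj_iff hB).1 hxB⟩
  · rintro ⟨⟨x, hxA, rfl⟩, hxB⟩
    exact ⟨x, ⟨hxA, mt (mk_mem_proj_iff hB).2 hxB⟩, rfl⟩

theorem proj_symmDiff (hA : H ≤ stabilizer G A) (hB : H ≤ stabilizer G B) :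
    proj H (A ∆ B) = proj H A ∆ proj H B := by
  rw [Set.symmDiff_def, Set.symmDiff_def, ← proj_sdiff hA, ← proj_sdiff hB]
  exact Set.image_union ..

theorem proj_preimage_mul_right (g : G) :
    proj H ((· * g) ⁻¹' X) = cosetMulRight H g⁻¹ '' proj H X := by
  ext q
  constructor
  · rintro ⟨x, hx, rfl⟩
    exact ⟨Cosets.mk H (x * g), ⟨x * g, hx, rfl⟩, congrArg (Cosets.mk H) (mul_inv_cancel_right x g)⟩
  · rintro ⟨_, ⟨x, hx, rfl⟩, rfl⟩
    exact ⟨x * g⁻¹, by simpa using hx, rfl⟩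

theorem exists_finset_subset_of_proj_finite (hA : (proj H A).Finite) :
    ∃ F : Finset G, ↑F ⊆ A ∧ A ⊆ (H : Set G) * (F : Set G) := by
  obtain ⟨F, hFA, hF, hproj⟩ := hA.exists_subset_finite_image_eq subset_rfl
  refine ⟨hF.toFinset, by simpa using hFA, fun x hx => ?_⟩
  obtain ⟨f, hf, hfx⟩ : Cosets.mk H x ∈ Cosets.mk H '' F := hproj ▸ Set.mem_image_of_mem _ hx
  exact ⟨x * f⁻¹, Cosets.mk_eq_mk_iff.1 hfx, f, by simpa using hf, inv_mul_cancel_right x f⟩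

theorem proj_finite_iff : (proj H A).Finite ↔ HFinite H A := by
  refine ⟨fun hA => (exists_finset_subset_of_proj_finite hA).imp fun _ hF => hF.2, ?_⟩
  rintro ⟨F, hF⟩
  refine (F.finite_toSet.image (Cosets.mk H)).subset ?_
  rintro _ ⟨x, hx, rfl⟩
  obtain ⟨h, hh, f, hf, rfl⟩ := hF hx
  exact ⟨f, hf, Cosets.mk_eq_mk_iff.2 (by simpa using hh)⟩

namespace HFinite

theorem mono (hB : HFinite H B) (hAB : A ⊆ B) : HFinite H A :=
  hB.imp fun _ hF => hAB.trans hF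

theorem empty : HFinite H (∅ : Set G) :=
  ⟨∅, Set.empty_subset _⟩

theorem union (hA : HFinite H A) (hB : HFinite H B) : HFinite H (A ∪ B) := by
  rw [← proj_finite_iff] at *
  exact (hA.union hB).subset (Set.image_union ..).subset

theorem biUnion {ι : Type*} {s : Set ι} (hs : s.Finite) {A : ι → Set G}
    (hA : ∀ i ∈ s, HFinite H (A i)) : HFinite H (⋃ i ∈ s, A i) := by
  simp only [← proj_finite_iff] at *
  exact (hs.biUnion hA).subset (Set.image_iUnion₂ ..).subset

theorem preimage_mul_right (hA : HFinite H A) (g : G) : HFinite H ((· * g) ⁻¹' A) := by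
  rw [← proj_finite_iff] at *
  rw [proj_preimage_mul_right]
  exact hA.image _

theorem symmDiff_trans (hAB : HFinite H (A ∆ B)) (hBC : HFinite H (B ∆ C)) :
    HFinite H (A ∆ C) :=
  (hAB.union hBC).mono (symmDiff_triangle A B C)

theorem of_symmDiff (hB : HFinite H B) (hAB : HFinite H (A ∆ B)) : HFinite H A :=
  symmDiff_bot A ▸ hAB.symmDiff_trans ((symmDiff_bot B).symm ▸ hB)

theorem refl (H : Subgroup G) : HFinite H (H : Set G) :=
  ⟨{1}, by simp⟩

theorem of_le (hHK : H ≤ K) (hA : HFinite H A) : HFinite K A :=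
  hA.imp fun _ hF => hF.trans (Set.mul_subset_mul_right hHK)

theorem trans (hK : HFinite H (K : Set G)) (hA : HFinite K A) : HFinite H A := by
  classical
  obtain ⟨F₁, hF₁⟩ := hK
  obtain ⟨F₂, hF₂⟩ := hA
  refine ⟨F₁ * F₂, hF₂.trans ?_⟩
  rw [Finset.coe_mul, ← mul_assoc]
  exact Set.mul_subset_mul_right hF₁

theorem coe_mul (hA : HFinite H A) : HFinite H (H * A) := by
  obtain ⟨F, hF⟩ := hA
  refine ⟨F, (Set.mul_subset_mul_left hF).trans ?_⟩
  rw [← mul_assoc, coe_mul_coe]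

theorem inf (hH : HFinite H A) (hK : HFinite K A) : HFinite (H ⊓ K) A := by
  rw [← proj_finite_iff] at *
  have mk_out (x : G) : x * (Cosets.mk (H ⊓ K) x).out⁻¹ ∈ H ⊓ K :=
    Cosets.mk_eq_mk_iff.1 (Quotient.out_eq _)
  refine (hH.prod hK).of_injOn
    (f := fun q => (Cosets.mk H q.out, Cosets.mk K q.out)) ?_ fun p _ q _ hpq => ?_
  · rintro _ ⟨x, hx, rfl⟩
    exact ⟨⟨x, hx, (Cosets.mk_eq_mk_iff.2 (mk_out x).1).symm⟩,
      ⟨x, hx, (Cosets.mk_eq_mk_iff.2 (mk_out x).2).symm⟩⟩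
  · rw [Prod.mk.injEq, Cosets.mk_eq_mk_iff, Cosets.mk_eq_mk_iff] at hpq
    rw [← Quotient.out_eq p, ← Quotient.out_eq q]
    exact Cosets.mk_eq_mk_iff.2 hpq

end HFinite

/-- The number of cosets of `H` that meet `A`. -/
noncomputable def cosetCount (H : Subgroup G) (A : Set G) : ℕ∞ := (proj H A).encard

theorem cosetCount_eq_top_iff : cosetCount H A = ⊤ ↔ ¬ HFinite H A := by
  rw [cosetCount, Set.encard_eq_top_iff, ← proj_finite_iff, Set.Infinite]

theorem cosetCount_eq_zero_iff : cosetCount H A = 0 ↔ A = ∅ := by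
  rw [cosetCount, Set.encard_eq_zero, proj, Set.image_eq_empty]

theorem cosetCount_conj_smul (g : G) :
    cosetCount (MulAut.conj g • H) (g • A) = cosetCount H A := by
  have rel_iff (x y : G) :
      QuotientGroup.rightRel H x y ↔
        QuotientGroup.rightRel (MulAut.conj g • H) (g * x) (g * y) := by
    rw [QuotientGroup.rightRel_apply, QuotientGroup.rightRel_apply,
      Subgroup.mem_pointwise_smul_iff_inv_smul_mem]
    simp [mul_assoc]
  let e : Cosets H ≃ Cosets (MulAut.conj g • H) := Quotient.congr (Equiv.mulLeft g) rel_iff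
  have proj_smul : proj (MulAut.conj g • H) (g • A) = e '' proj H A := by
    rw [proj, proj, ← Set.image_smul, Set.image_image, Set.image_image]
    rfl
  rw [cosetCount, proj_smul, e.injective.encard_image, cosetCount]

theorem HFinite.conj_smul_iff (g : G) :
    HFinite (MulAut.conj g • H) (g • A) ↔ HFinite H A := by
  rw [← not_iff_not, ← cosetCount_eq_top_iff, cosetCount_conj_smul, cosetCount_eq_top_iff]

/-- Every coset `Kx` is a disjoint union of the same number `|H\K|` of cosets of `H`. -/
theorem cosetCount_mul_of_le (hHK : H ≤ K) (hA : K ≤ stabilizer G A) :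
    cosetCount H A = cosetCount K A * cosetCount H (K : Set G) := by
  let Φ : Cosets K × Cosets H → Cosets H := fun p => cosetMulRight H p.1.out p.2
  have mk_out (x : G) : (Cosets.mk K x).out * x⁻¹ ∈ K :=
    Cosets.mk_eq_mk_iff.1 (Quotient.out_eq _).symm
  have image_eq : Φ '' (proj K A ×ˢ proj H K) = proj H A := by
    ext q
    constructor
    · rintro ⟨⟨_, _⟩, ⟨⟨x, hx, rfl⟩, ⟨k, hk, rfl⟩⟩, rfl⟩
      refine ⟨k * (Cosets.mk K x).out, ?_, rfl⟩
      rw [← inv_mul_cancel_right (Cosets.mk K x).out x, ← mul_assoc]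
      exact (mul_mem_iff_of_mem_stabilizer (hA (K.mul_mem hk (mk_out x)))).2 hx
    · rintro ⟨x, hx, rfl⟩
      refine ⟨(Cosets.mk K x, Cosets.mk H (x * (Cosets.mk K x).out⁻¹)),
        ⟨⟨x, hx, rfl⟩, ⟨_, by simpa using K.inv_mem (mk_out x), rfl⟩⟩, ?_⟩
      exact congrArg (Cosets.mk H) (inv_mul_cancel_right _ _)
  have injOn : Set.InjOn Φ (proj K A ×ˢ proj H K) := by
    rintro ⟨p, _⟩ ⟨-, ⟨k, hk, rfl⟩⟩ ⟨p', _⟩ ⟨-, ⟨k', hk', rfl⟩⟩ h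
    have mem : k' * p'.out * (k * p.out)⁻¹ ∈ H := Cosets.mk_eq_mk_iff.1 h
    have hpp' : p = p' := by
      rw [← Quotient.out_eq p, ← Quotient.out_eq p']
      refine Cosets.mk_eq_mk_iff.2 ?_
      simpa [mul_assoc] using K.mul_mem (K.mul_mem (K.inv_mem hk') (hHK mem)) hk
    subst hpp'
    exact Prod.ext rfl (Cosets.mk_eq_mk_iff.2 (by simpa [mul_assoc] using mem))
  rw [cosetCount, ← image_eq, injOn.encard_image, Set.encard_prod, cosetCount, cosetCount]

theorem cosetCount_le_cosetCount_of_le (hHK : H ≤ K) (hA : K ≤ stabilizer G A)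
    (hB : K ≤ stabilizer G B) (h : cosetCount K A ≤ cosetCount K B) :
    cosetCount H A ≤ cosetCount H B := by
  rw [cosetCount_mul_of_le hHK hA, cosetCount_mul_of_le hHK hB]
  gcongr

theorem cosetCount_le_cosetCount_iff (hHK : H ≤ K) (hK : HFinite H (K : Set G))
    (hA : K ≤ stabilizer G A) (hB : K ≤ stabilizer G B) :
    cosetCount H A ≤ cosetCount H B ↔ cosetCount K A ≤ cosetCount K B := by
  rw [cosetCount_mul_of_le hHK hA, cosetCount_mul_of_le hHK hB, ENat.mul_le_mul_right_iff]
  · exact cosetCount_eq_zero_iff.not.2 (OneMemClass.coe_nonempty K).ne_empty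
  · exact fun h => cosetCount_eq_top_iff.1 h hK

/-- Every point leaves and enters `u`, `v`, `w` equally often along the cycle `u, v, w, u`. -/
theorem encard_sdiff_cycle {α : Type*} (u v w : Set α) :
    (u \ v).encard + (v \ w).encard + (w \ u).encard =
      (v \ u).encard + (w \ v).encard + (u \ w).encard := by
  have split (a b c : Set α) :
      (a \ b).encard = ((a ∩ c) \ b).encard + (a \ (b ∪ c)).encard := by
    rw [← Set.encard_sdiff_add_encard_inter (a \ b) c, add_comm, Set.sdiff_inter_right_comm,
      Set.sdiff_sdiff]
  rw [split u v w, split v w u, split w u v, split v u w, split w v u, split u w v,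
    Set.inter_comm v u, Set.inter_comm w v, Set.inter_comm w u, Set.union_comm v w,
    Set.union_comm w u, Set.union_comm u v]
  ac_rfl

theorem encard_sdiff_le_trans {α : Type*} {u v w : Set α} (huv : (u \ v).Finite)
    (hvw : (v \ w).Finite) (h : (u \ v).encard ≤ (v \ u).encard)
    (h' : (v \ w).encard ≤ (w \ v).encard) : (u \ w).encard ≤ (w \ u).encard := by
  have ne_top : (u \ v).encard + (v \ w).encard ≠ ⊤ := by
    simpa using ⟨huv, hvw⟩
  rw [← ENat.add_le_add_iff_left ne_top, encard_sdiff_cycle u v w]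
  gcongr

theorem cosetCount_sdiff_le_trans (hA : H ≤ stabilizer G A) (hB : H ≤ stabilizer G B)
    (hC : H ≤ stabilizer G C) (hAB : HFinite H (A \ B)) (hBC : HFinite H (B \ C))
    (h : cosetCount H (A \ B) ≤ cosetCount H (B \ A))
    (h' : cosetCount H (B \ C) ≤ cosetCount H (C \ B)) :
    cosetCount H (A \ C) ≤ cosetCount H (C \ A) := by
  simp only [← proj_finite_iff, cosetCount, proj_sdiff hA, proj_sdiff hB, proj_sdiff hC] at *
  exact encard_sdiff_le_trans hAB hBC h h'

end Cosets

section AlmostInvariant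

variable {H L M : Subgroup G} {A U V W X Z : Set G}

theorem le_stabilizer_preimage_mul_right (hX : H ≤ stabilizer G X) (g : G) :
    H ≤ stabilizer G ((· * g) ⁻¹' X) := fun h hh => by
  refine MulAction.mem_stabilizer_set.2 fun x => ?_
  rw [smul_eq_mul, Set.mem_preimage, mul_assoc, mul_mem_iff_of_mem_stabilizer (hX hh),
    Set.mem_preimage]

theorem isAlmostInvariant_iff :
    IsAlmostInvariant H X ↔
      H ≤ stabilizer G X ∧ ∀ g, HFinite H (((· * g) ⁻¹' X) ∆ X) := by
  refine and_congr_right fun hX : H ≤ stabilizer G X => (Equiv.inv G).forall_congr fun g => ?_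
  rw [← proj_finite_iff, proj_symmDiff (le_stabilizer_preimage_mul_right hX _) hX,
    proj_preimage_mul_right, Equiv.inv_apply, inv_inv]

theorem isNontrivialAlmostInvariant_iff :
    IsNontrivialAlmostInvariant H X ↔
      H ≤ stabilizer G X ∧ (∀ g, HFinite H (((· * g) ⁻¹' X) ∆ X)) ∧
        ¬ HFinite H X ∧ ¬ HFinite H Xᶜ := by
  rw [IsNontrivialAlmostInvariant, isAlmostInvariant_iff, Set.Infinite, Set.Infinite,
    proj_finite_iff, proj_finite_iff, and_assoc]

theorem exists_coset_subset_sdiff (hU : L ≤ stabilizer G U) (hU' : ¬ HFinite L U)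
    (hA : HFinite L A) : ∃ y, ∀ l ∈ L, l * y ∈ U \ A := by
  rw [← proj_finite_iff] at hU' hA
  obtain ⟨_, ⟨y, hyU, rfl⟩, hyA⟩ := (Set.Infinite.sdiff hU' hA).nonempty
  refine ⟨y, fun l hl => ⟨(mul_mem_iff_of_mem_stabilizer (hU hl)).2 hyU, fun hlA => hyA ?_⟩⟩
  exact ⟨l * y, hlA, Cosets.mk_eq_mk_iff.2 (by simpa using hl)⟩

theorem HFinite.of_coset_disjoint (hA : HFinite L A) (hAV : A ⊆ V)
    (hV : ∀ g, HFinite M (((· * g) ⁻¹' V) ∆ V)) {y : G} (hy : ∀ l ∈ L, l * y ∉ V) :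
    HFinite M A := by
  obtain ⟨F, hF⟩ := hA
  refine (HFinite.biUnion F.finite_toSet fun f _ => hV (f⁻¹ * y)).mono fun x hx => ?_
  obtain ⟨l, hl, f, hf, rfl⟩ := hF hx
  refine Set.mem_biUnion hf (Or.inr ⟨hAV hx, ?_⟩)
  simpa [mul_assoc] using hy l hl

theorem hfinite_preimage_symmDiff_congr (hX : ∀ g, HFinite H (((· * g) ⁻¹' X) ∆ X))
    (hXZ : HFinite H (X ∆ Z)) (g : G) : HFinite H (((· * g) ⁻¹' Z) ∆ Z) := by
  have hZX : HFinite H (((· * g) ⁻¹' Z) ∆ ((· * g) ⁻¹' X)) :=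
    (symmDiff_comm X Z ▸ hXZ).preimage_mul_right g
  exact (hZX.symmDiff_trans (hX g)).symmDiff_trans hXZ

theorem hfinite_stabilizer (hU : ∀ g, HFinite M (((· * g) ⁻¹' U) ∆ U)) (hne : U.Nonempty)
    (hne' : Uᶜ.Nonempty) : HFinite M (stabilizer G U : Set G) := by
  obtain ⟨x, hx⟩ := hne
  obtain ⟨y, hy⟩ := hne'
  refine ((hU (x⁻¹ * y)).preimage_mul_right x).mono fun k hk => Or.inr ⟨?_, ?_⟩
  · exact (mul_mem_iff_of_mem_stabilizer hk).2 hx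
  · rw [Set.mem_preimage, mul_assoc, mul_inv_cancel_left]
    exact mt (mul_mem_iff_of_mem_stabilizer hk).1 hy

namespace IsNontrivialAlmostInvariant

theorem le_stabilizer (hX : IsNontrivialAlmostInvariant H X) : H ≤ stabilizer G X :=
  (isNontrivialAlmostInvariant_iff.1 hX).1

theorem hfinite_preimage_symmDiff (hX : IsNontrivialAlmostInvariant H X) :
    ∀ g, HFinite H (((· * g) ⁻¹' X) ∆ X) :=
  (isNontrivialAlmostInvariant_iff.1 hX).2.1

theorem not_hfinite (hX : IsNontrivialAlmostInvariant H X) : ¬ HFinite H X :=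
  (isNontrivialAlmostInvariant_iff.1 hX).2.2.1

theorem not_hfinite_compl (hX : IsNontrivialAlmostInvariant H X) : ¬ HFinite H Xᶜ :=
  (isNontrivialAlmostInvariant_iff.1 hX).2.2.2

theorem nonempty (hX : IsNontrivialAlmostInvariant H X) : X.Nonempty :=
  Set.nonempty_iff_ne_empty.2 fun h => hX.not_hfinite (h ▸ HFinite.empty)

theorem compl (hX : IsNontrivialAlmostInvariant H X) : IsNontrivialAlmostInvariant H Xᶜ := by
  refine isNontrivialAlmostInvariant_iff.2 ⟨?_, fun g => ?_, hX.not_hfinite_compl, ?_⟩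
  · rw [stabilizer_compl]
    exact hX.le_stabilizer
  · rw [Set.preimage_compl, compl_symmDiff_compl]
    exact hX.hfinite_preimage_symmDiff g
  · rw [compl_compl]
    exact hX.not_hfinite

theorem conj_smul (hX : IsNontrivialAlmostInvariant H X) (g : G) :
    IsNontrivialAlmostInvariant (MulAut.conj g • H) (g • X) := by
  refine isNontrivialAlmostInvariant_iff.2 ⟨?_, fun k => ?_, ?_, ?_⟩
  · rw [MulAction.stabilizer_smul_eq_stabilizer_map_conj]
    exact Subgroup.map_mono hX.le_stabilizer
  · have preimage_smul : (· * k) ⁻¹' (g • X) = g • (· * k) ⁻¹' X := by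
      ext x
      simp [Set.mem_smul_set_iff_inv_smul_mem, mul_assoc]
    rw [preimage_smul, ← Set.smul_set_symmDiff, HFinite.conj_smul_iff]
    exact hX.hfinite_preimage_symmDiff k
  · rw [HFinite.conj_smul_iff]
    exact hX.not_hfinite
  · rw [← Set.smul_set_compl, HFinite.conj_smul_iff]
    exact hX.not_hfinite_compl

theorem of_hfinite_symmDiff (hX : IsNontrivialAlmostInvariant H X) (hZ : H ≤ stabilizer G Z)
    (hXZ : HFinite H (X ∆ Z)) : IsNontrivialAlmostInvariant H Z := by
  refine isNontrivialAlmostInvariant_iff.2 ⟨hZ,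
    hfinite_preimage_symmDiff_congr hX.hfinite_preimage_symmDiff hXZ,
    fun h => hX.not_hfinite ?_, fun h => hX.not_hfinite_compl ?_⟩
  · exact h.of_symmDiff hXZ
  · exact h.of_symmDiff (compl_symmDiff_compl X Z ▸ hXZ)

theorem hfinite_iff_hfinite_stabilizer (hX : IsNontrivialAlmostInvariant H X) :
    HFinite H W ↔ HFinite (stabilizer G X) W :=
  ⟨HFinite.of_le hX.le_stabilizer,
    (hfinite_stabilizer hX.hfinite_preimage_symmDiff hX.nonempty hX.compl.nonempty).trans⟩

theorem stabilizer (hX : IsNontrivialAlmostInvariant H X) :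
    IsNontrivialAlmostInvariant (stabilizer G X) X := by
  simp only [isNontrivialAlmostInvariant_iff, ← hX.hfinite_iff_hfinite_stabilizer]
  exact ⟨le_rfl, (isNontrivialAlmostInvariant_iff.1 hX).2⟩

theorem hfinite_sdiff_swap (hU : IsNontrivialAlmostInvariant L U)
    (hV : IsNontrivialAlmostInvariant M V) (h : HFinite L (U \ V)) : HFinite M (U \ V) := by
  obtain ⟨y, hy⟩ := exists_coset_subset_sdiff hU.le_stabilizer hU.not_hfinite h
  refine h.of_coset_disjoint (V := Vᶜ) (fun x hx => hx.2) hV.compl.hfinite_preimage_symmDiff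
    fun l hl hlV => (hy l hl).2 ⟨(hy l hl).1, hlV⟩

theorem hfinite_sdiff_iff (hU : IsNontrivialAlmostInvariant L U)
    (hV : IsNontrivialAlmostInvariant M V) : HFinite L (U \ V) ↔ HFinite M (U \ V) := by
  refine ⟨hU.hfinite_sdiff_swap hV, fun h => ?_⟩
  rw [← compl_sdiff_compl] at h ⊢
  exact hV.compl.hfinite_sdiff_swap hU.compl h

theorem hfinite_sdiff_trans (hU : IsNontrivialAlmostInvariant L U)
    (hV : IsNontrivialAlmostInvariant M V) (hUV : HFinite L (U \ V)) (hVW : HFinite M (V \ W)) :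
    HFinite L (U \ W) := by
  have hUV' := (hU.hfinite_sdiff_iff hV).1 hUV
  obtain ⟨y, hy⟩ :=
    exists_coset_subset_sdiff hV.compl.le_stabilizer hV.not_hfinite_compl hUV'
  have hUW : HFinite M (U \ W) := (hUV'.union hVW).mono (sdiff_triangle U V W)
  exact hUW.of_coset_disjoint Set.sdiff_subset hU.hfinite_preimage_symmDiff
    fun l hl hlU => (hy l hl).2 ⟨hlU, (hy l hl).1⟩

end IsNontrivialAlmostInvariant
end AlmostInvariant

/-- A nontrivial almost invariant set over its full stabilizer. No group is recorded: a group over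
which a set is nontrivial almost invariant has finite index in the stabilizer of the set. -/
@[ext]
structure AISet (G : Type*) [Group G] where
  carrier : Set G
  nontrivial : IsNontrivialAlmostInvariant (stabilizer G carrier) carrier

namespace AISet

instance : CoeOut (AISet G) (Set G) := ⟨carrier⟩

/-- The group over which `A` is regarded as almost invariant. -/
abbrev stab (A : AISet G) : Subgroup G := stabilizer G (A : Set G)

instance : SMul G (AISet G) := ⟨fun g A => ⟨g • (A : Set G), (A.nontrivial.conj_smul g).stabilizer⟩⟩

instance : Compl (AISet G) := ⟨fun A => ⟨(A : Set G)ᶜ, A.nontrivial.compl.stabilizer⟩⟩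

variable {A B C : AISet G}

theorem coe_smul (g : G) (A : AISet G) : ((g • A : AISet G) : Set G) = g • (A : Set G) := rfl

theorem coe_compl (A : AISet G) : ((Aᶜ : AISet G) : Set G) = (A : Set G)ᶜ := rfl

instance : MulAction G (AISet G) :=
  Function.Injective.mulAction carrier (fun _ _ => AISet.ext) coe_smul

theorem smul_compl (g : G) (A : AISet G) : g • Aᶜ = (g • A)ᶜ :=
  AISet.ext Set.smul_set_compl

theorem stab_smul (g : G) (A : AISet G) : (g • A).stab = MulAut.conj g • A.stab :=
  MulAction.stabilizer_smul_eq_stabilizer_map_conj g (A : Set G)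

theorem stab_compl (A : AISet G) : (Aᶜ).stab = A.stab :=
  stabilizer_compl G G

/-- Inclusion up to a subset which is finite modulo the group. -/
def AlmostSubset (A B : AISet G) : Prop := HFinite A.stab (A \ B)

theorem almostSubset_iff_hfinite_right : A.AlmostSubset B ↔ HFinite B.stab (A \ B) :=
  A.nontrivial.hfinite_sdiff_iff B.nontrivial

theorem AlmostSubset.trans (hAB : A.AlmostSubset B) (hBC : B.AlmostSubset C) :
    A.AlmostSubset C :=
  A.nontrivial.hfinite_sdiff_trans B.nontrivial hAB hBC

theorem AlmostSubset.compl (h : A.AlmostSubset B) : Bᶜ.AlmostSubset Aᶜ := by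
  rw [AlmostSubset, stab_compl, coe_compl, coe_compl, compl_sdiff_compl]
  exact almostSubset_iff_hfinite_right.1 h

theorem AlmostSubset.smul (h : A.AlmostSubset B) (g : G) : (g • A).AlmostSubset (g • B) := by
  rw [AlmostSubset, stab_smul, coe_smul, coe_smul, ← Set.smul_set_sdiff, HFinite.conj_smul_iff]
  exact h

theorem not_almostSubset_compl (A : AISet G) : ¬ A.AlmostSubset Aᶜ := fun h =>
  A.nontrivial.not_hfinite (by simpa only [AlmostSubset, coe_compl, sdiff_compl, inf_idem] using h)

theorem hfinite_stab_of_almostSubset (hAB : A.AlmostSubset B) (hBA : B.AlmostSubset A) :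
    HFinite B.stab (A.stab : Set G) :=
  hfinite_stabilizer
    (hfinite_preimage_symmDiff_congr B.nontrivial.hfinite_preimage_symmDiff
      (hBA.union (almostSubset_iff_hfinite_right.1 hAB)))
    A.nontrivial.nonempty A.nontrivial.compl.nonempty

/-- Almost inclusion, with the sizes of the two differences compared by counting cosets of the
intersection of the stabilizers. The second condition only matters for equivalent sets. -/
instance : LE (AISet G) :=
  ⟨fun A B => A.AlmostSubset B ∧
    cosetCount (A.stab ⊓ B.stab) (A \ B) ≤ cosetCount (A.stab ⊓ B.stab) (B \ A)⟩

theorem le_iff : A ≤ B ↔ A.AlmostSubset B ∧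
    cosetCount (A.stab ⊓ B.stab) (A \ B) ≤ cosetCount (A.stab ⊓ B.stab) (B \ A) :=
  Iff.rfl

theorem cosetCount_eq_top_of_not_almostSubset (h : ¬ A.AlmostSubset B) :
    cosetCount (A.stab ⊓ B.stab) (A \ B) = ⊤ :=
  cosetCount_eq_top_iff.2 (mt (HFinite.of_le inf_le_left) h)

theorem le_or_ge_of_almostSubset (h : A.AlmostSubset B) : A ≤ B ∨ B ≤ A := by
  rw [le_iff, le_iff, inf_comm B.stab]
  by_cases hBA : B.AlmostSubset A
  · exact (le_total _ _).imp (And.intro h) (And.intro hBA)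
  · left
    rw [inf_comm, cosetCount_eq_top_of_not_almostSubset hBA]
    exact ⟨h, le_top⟩

theorem inf_stab_le_stabilizer_sdiff : A.stab ⊓ B.stab ≤ stabilizer G ((A : Set G) \ B) :=
  MulAction.stabilizer_inf_stabilizer_le_stabilizer_sdiff

/-- If `A`, `B`, `C` are pairwise equivalent, their stabilizers are commensurable and the sizes can
be compared over the intersection of all three; otherwise `C \ A` is infinitely large. -/
theorem cosetCount_sdiff_le_of_le_of_le (hAB : A ≤ B) (hBC : B ≤ C) :
    cosetCount (A.stab ⊓ C.stab) (A \ C) ≤ cosetCount (A.stab ⊓ C.stab) (C \ A) := by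
  by_cases hCA : C.AlmostSubset A
  swap
  · rw [inf_comm, cosetCount_eq_top_of_not_almostSubset hCA]
    exact le_top
  have hBA := hBC.1.trans hCA
  have hAC := hAB.1.trans hBC.1
  let T := A.stab ⊓ B.stab ⊓ C.stab
  have hTA : HFinite T (A.stab : Set G) :=
    ((HFinite.refl A.stab).inf (hfinite_stab_of_almostSubset hAB.1 hBA)).inf
      (hfinite_stab_of_almostSubset hAC hCA)
  have hTAB : T ≤ A.stab ⊓ B.stab := inf_le_left
  have hTBC : T ≤ B.stab ⊓ C.stab := inf_le_inf_right _ inf_le_right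
  have hTAC : T ≤ A.stab ⊓ C.stab := inf_le_inf_right _ inf_le_left
  have mono {P Q : AISet G} (hT : T ≤ P.stab ⊓ Q.stab) (hPQ : P ≤ Q) :
      cosetCount T (P \ Q) ≤ cosetCount T (Q \ P) :=
    cosetCount_le_cosetCount_of_le hT inf_stab_le_stabilizer_sdiff
      (inf_comm P.stab _ ▸ inf_stab_le_stabilizer_sdiff) hPQ.2
  rw [← cosetCount_le_cosetCount_iff hTAC (hTA.mono inf_le_left) inf_stab_le_stabilizer_sdiff
    (inf_comm A.stab _ ▸ inf_stab_le_stabilizer_sdiff)]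
  refine cosetCount_sdiff_le_trans (hTAB.trans inf_le_left) (hTBC.trans inf_le_left)
    (hTBC.trans inf_le_right) (hTA.trans hAB.1) ?_ (mono hTAB hAB) (mono hTBC hBC)
  exact hTA.trans ((hfinite_stab_of_almostSubset hBA hAB.1).trans hBC.1)

instance : Preorder (AISet G) where
  le_refl A := ⟨by simpa [AlmostSubset] using HFinite.empty, le_rfl⟩
  le_trans A B C hAB hBC := ⟨hAB.1.trans hBC.1, cosetCount_sdiff_le_of_le_of_le hAB hBC⟩

theorem smul_le_smul (h : A ≤ B) (g : G) : g • A ≤ g • B := by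
  refine ⟨h.1.smul g, ?_⟩
  rw [stab_smul, stab_smul, ← Subgroup.smul_inf, coe_smul, coe_smul, ← Set.smul_set_sdiff,
    ← Set.smul_set_sdiff, cosetCount_conj_smul, cosetCount_conj_smul]
  exact h.2

theorem compl_le_compl (h : A ≤ B) : Bᶜ ≤ Aᶜ := by
  refine ⟨h.1.compl, ?_⟩
  rw [stab_compl, stab_compl, inf_comm, coe_compl, coe_compl, compl_sdiff_compl, compl_sdiff_compl]
  exact h.2

theorem subset_of_le_of_nested (h : A ≤ B) (hn : Nested (A : Set G) B) : (A : Set G) ⊆ B := by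
  rcases hn with hn | hn | hn | hn
  · refine absurd h.1 ?_
    rw [AlmostSubset, (Set.disjoint_iff_inter_eq_empty.2 hn).sdiff_eq_left]
    exact A.nontrivial.not_hfinite
  · have hBA : (B \ A : Set G) = ∅ := by rw [Set.sdiff_eq, Set.inter_comm, hn]
    have hcount := h.2
    rw [cosetCount_eq_zero_iff.2 hBA, nonpos_iff_eq_zero, cosetCount_eq_zero_iff] at hcount
    exact Set.sdiff_eq_empty.1 hcount
  · exact Set.sdiff_eq_empty.1 hn
  · refine absurd (almostSubset_iff_hfinite_right.1 h.1) ?_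
    rw [← compl_sdiff_compl, (Set.disjoint_iff_inter_eq_empty.2 hn).symm.sdiff_eq_left]
    exact B.nontrivial.not_hfinite_compl

end AISet

section Nested

variable {α : Type*} {P Q : Set α}

theorem nested_comm : Nested P Q ↔ Nested Q P := by
  simp only [Nested, Set.inter_comm Q, Set.inter_comm Qᶜ]
  tauto

theorem nested_compl_right : Nested P Qᶜ ↔ Nested P Q := by
  simp only [Nested, compl_compl]
  tauto

theorem nested_compl_left : Nested Pᶜ Q ↔ Nested P Q := by
  rw [nested_comm, nested_compl_right, nested_comm]

end Nested

section Frontier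

variable {H K : Subgroup G} {S B D U V X Y : Set G}

/-- The vertices `x` of the Cayley graph of `G` for which some edge from `x` to `x * s`, with
`s ∈ S`, joins `U` to its complement. -/
def frontier (S U : Set G) : Set G := ⋃ s ∈ S, ((· * s) ⁻¹' U) ∆ U

theorem mul_mem_iff_of_notMem_frontier {x s : G} (hx : x ∉ frontier S U) (hs : s ∈ S) :
    x * s ∈ U ↔ x ∈ U := by
  by_contra h
  refine hx (Set.mem_biUnion hs ?_)
  rw [Set.mem_symmDiff, Set.mem_preimage]
  tauto

theorem frontier_compl (S U : Set G) : frontier S Uᶜ = frontier S U := by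
  simp only [frontier, Set.preimage_compl, compl_symmDiff_compl]

theorem frontier_smul (S U : Set G) (g : G) : frontier S (g • U) = g • frontier S U := by
  ext x
  simp [frontier, Set.mem_smul_set_iff_inv_smul_mem, Set.mem_symmDiff, mul_assoc]

theorem hfinite_frontier (hS : S.Finite) (hX : ∀ g, HFinite H (((· * g) ⁻¹' X) ∆ X)) :
    HFinite H (frontier S X) :=
  HFinite.biUnion hS fun s _ => hX s

theorem subset_or_subset_compl_of_disjoint_frontier (hH : Submonoid.closure S = H.toSubmonoid)
    (h : Disjoint (H : Set G) (frontier (S ∪ B) U)) :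
    (H * B : Set G) ⊆ U ∨ (H * B : Set G) ⊆ Uᶜ := by
  have mem_iff {x b : G} (hx : x ∈ H) (hb : b ∈ S ∪ B) : x * b ∈ U ↔ x ∈ U :=
    mul_mem_iff_of_notMem_frontier (Set.disjoint_left.1 h hx) hb
  have mem_iff_one {x : G} (hx : x ∈ Submonoid.closure S) : x ∈ U ↔ 1 ∈ U := by
    induction hx using Submonoid.closure_induction_right with
    | one => rfl
    | mul_right x hx s hs ih => rw [mem_iff (hH.le hx) (Or.inl hs), ih]
  have mul_mem_iff_one {x b : G} (hx : x ∈ H) (hb : b ∈ B) : x * b ∈ U ↔ 1 ∈ U := by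
    rw [mem_iff hx (Or.inr hb), mem_iff_one (hH.ge hx)]
  refine (em (1 ∈ U)).imp ?_ ?_ <;> rintro h1 _ ⟨x, hx, b, hb, rfl⟩
  · exact (mul_mem_iff_one hx hb).2 h1
  · exact mt (mul_mem_iff_one hx hb).1 h1

theorem exists_finite_disjoint_smul (H : Subgroup G) (hD : HFinite K D) :
    ∃ F : Set G, F.Finite ∧ ∀ t ∉ (H : Set G) * F * K, Disjoint (H : Set G) (t • D) := by
  obtain ⟨F, hF⟩ := hD
  refine ⟨(F : Set G)⁻¹, F.finite_toSet.inv, fun t ht => Set.disjoint_left.2 fun h hh hD => ht ?_⟩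
  obtain ⟨k, hk, f, hf, e⟩ := hF (Set.mem_smul_set_iff_inv_smul_mem.1 hD)
  refine ⟨h * f⁻¹, ⟨h, hh, f⁻¹, Set.inv_mem_inv.2 hf, rfl⟩, k⁻¹, K.inv_mem hk, ?_⟩
  change k * f = t⁻¹ * h at e
  rw [eq_inv_mul_iff_mul_eq] at e
  simp [← e, mul_assoc]

theorem exists_finite_not_separating (hH : H.FG) (hB : B.Finite)
    (hY : ∀ g, HFinite K (((· * g) ⁻¹' Y) ∆ Y)) :
    ∃ F : Set G, F.Finite ∧ ∀ t ∉ (H : Set G) * F * K,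
      (H * B : Set G) ⊆ t • Y ∨ (H * B : Set G) ⊆ (t • Y)ᶜ := by
  obtain ⟨S, hS⟩ := (Subgroup.fg_iff_submonoid_fg H).1 hH
  obtain ⟨F, hF, hdisj⟩ :=
    exists_finite_disjoint_smul H (hfinite_frontier (S.finite_toSet.union hB) hY)
  refine ⟨F, hF, fun t ht => subset_or_subset_compl_of_disjoint_frontier hS ?_⟩
  rw [frontier_smul]
  exact hdisj t ht

theorem nested_of_frontier_subset_compl (hS : Submonoid.closure S = ⊤) (hU : frontier S U ⊆ Vᶜ)
    (hV : frontier S V ⊆ Uᶜ) : Nested U V := by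
  rcases (U ∩ V).eq_empty_or_nonempty with hUV | ⟨x, hx⟩
  · exact Or.inl hUV
  have mul_mem {g : G} (hg : g ∈ Submonoid.closure S) : x * g ∈ U ∩ V := by
    induction hg using Submonoid.closure_induction_right with
    | one => rwa [mul_one]
    | mul_right g _ s hs ih =>
      rw [← mul_assoc]
      exact ⟨(mul_mem_iff_of_notMem_frontier (fun h => hU h ih.2) hs).2 ih.1,
        (mul_mem_iff_of_notMem_frontier (fun h => hV h ih.1) hs).2 ih.2⟩
  have U_eq_univ : U = Set.univ := Set.eq_univ_of_forall fun y => by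
    simpa using (mul_mem (g := x⁻¹ * y) (hS ▸ Submonoid.mem_top _)).1
  right; left
  rw [U_eq_univ, Set.compl_univ, Set.empty_inter]

theorem nested_of_frontier (hS : Submonoid.closure S = ⊤)
    (hU : frontier S U ⊆ V ∨ frontier S U ⊆ Vᶜ) (hV : frontier S V ⊆ U ∨ frontier S V ⊆ Uᶜ) :
    Nested U V := by
  wlog hU' : frontier S U ⊆ Vᶜ generalizing V
  · rw [← nested_compl_right]
    refine this ?_ ?_ ?_ <;> simp only [frontier_compl, compl_compl] <;> tauto
  wlog hV' : frontier S V ⊆ Uᶜ generalizing U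
  · rw [← nested_compl_left]
    refine this ?_ ?_ ?_ ?_ <;> simp only [frontier_compl, compl_compl] <;> tauto
  exact nested_of_frontier_subset_compl hS hU' hV'

theorem exists_finite_nested (hG : Group.FG G) (hH : H.FG) (hK : K.FG)
    (hX : ∀ g, HFinite H (((· * g) ⁻¹' X) ∆ X)) (hY : ∀ g, HFinite K (((· * g) ⁻¹' Y) ∆ Y)) :
    ∃ F : Set G, F.Finite ∧ ∀ t ∉ (H : Set G) * F * K, Nested X (t • Y) := by
  obtain ⟨S, hS⟩ := (Group.fg_iff_monoid_fg.1 hG).fg_top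
  obtain ⟨B, hB⟩ := hfinite_frontier S.finite_toSet hX
  obtain ⟨C, hC⟩ := hfinite_frontier S.finite_toSet hY
  obtain ⟨F, hF, hFY⟩ := exists_finite_not_separating hH B.finite_toSet hY
  obtain ⟨F', hF', hFX⟩ := exists_finite_not_separating hK C.finite_toSet hX
  refine ⟨F ∪ F'⁻¹, hF.union hF'.inv, fun t ht => ?_⟩
  rw [Set.mul_union, Set.union_mul, Set.mem_union, not_or] at ht
  refine nested_of_frontier hS ?_ ?_
  · exact (hFY t ht.1).imp hB.trans hB.trans
  · have ht' : t⁻¹ ∉ (K : Set G) * F' * H := by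
      rw [← Set.mem_inv]
      simpa [mul_assoc] using ht.2
    rw [frontier_smul, Set.smul_set_subset_iff_subset_inv_smul_set,
      Set.smul_set_subset_iff_subset_inv_smul_set, Set.smul_set_compl]
    exact (hFX _ ht').imp hC.trans hC.trans

end Frontier

theorem fg_of_hfinite {H K : Subgroup G} (hH : H.FG) (hHK : H ≤ K) (h : HFinite H (K : Set G)) :
    K.FG := by
  obtain ⟨F, hFK, hF⟩ := exists_finset_subset_of_proj_finite (proj_finite_iff.2 h)
  have hK : K = H ⊔ Subgroup.closure F := by
    refine le_antisymm (fun x hx => ?_) (sup_le hHK ((Subgroup.closure_le K).2 hFK))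
    obtain ⟨h, hh, f, hf, rfl⟩ := hF hx
    exact Subgroup.mul_mem_sup hh (Subgroup.subset_closure hf)
  exact hK ▸ hH.sup ⟨F, rfl⟩

theorem fg_conj_smul {H : Subgroup G} (hH : H.FG) (g : G) : (MulAut.conj g • H).FG := by
  rw [Subgroup.fg_iff_submonoid_fg] at hH ⊢
  exact hH.map (MulAut.conj g).toMonoidHom

/-- A preordered pocset: a preorder with an order-reversing involution which sends no element above
itself. -/
class Pocset (P : Type*) extends Preorder P, Compl P where
  compl_compl (a : P) : aᶜᶜ = a
  compl_le_compl {a b : P} : a ≤ b → bᶜ ≤ aᶜ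
  not_le_compl (a : P) : ¬ a ≤ aᶜ

namespace Pocset

variable {P : Type*} [Pocset P] {a b : P} {s : Set P}

/-- An ultrafilter on a pocset: an upper set which contains exactly one of `a` and `aᶜ`. The
vertices of the cubing dual to the pocset are among them. -/
structure IsUltrafilter (w : Set P) : Prop where
  isUpperSet : IsUpperSet w
  compl_mem_iff : ∀ a, aᶜ ∈ w ↔ a ∉ w

theorem le_compl_comm : a ≤ bᶜ ↔ b ≤ aᶜ :=
  ⟨fun h => by simpa only [compl_compl] using compl_le_compl h,
    fun h => by simpa only [compl_compl] using compl_le_compl h⟩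

theorem exists_isUltrafilter (hs : ∀ a ∈ s, ∀ b ∈ s, ¬ a ≤ bᶜ) :
    ∃ w, IsUltrafilter w ∧ s ⊆ w := by
  obtain ⟨w, hw, hsw⟩ := IsChain.exists_maxChain (r := fun a b : P => ¬ a ≤ bᶜ)
    (c := s) fun a ha b hb _ => Or.inl (hs a ha b hb)
  have not_le {a b : P} (ha : a ∈ w) (hb : b ∈ w) : ¬ a ≤ bᶜ := by
    rcases eq_or_ne a b with rfl | hab
    · exact not_le_compl a
    · exact (hw.1 ha hb hab).elim id (mt le_compl_comm.1)
  have mem_of_not_le {a : P} (ha : ∀ b ∈ w, ¬ b ≤ aᶜ) : a ∈ w := by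
    rw [hw.2 (hw.1.insert fun b hb _ => Or.inr (ha b hb)) (Set.subset_insert a w)]
    exact Set.mem_insert a w
  refine ⟨w, ⟨fun a b hab ha => mem_of_not_le fun c hc hcb => ?_, fun a => ⟨fun hac ha => ?_,
    fun ha => mem_of_not_le fun b hb hba => ?_⟩⟩, hsw⟩
  · exact not_le hc ha (hcb.trans (compl_le_compl hab))
  · exact not_le ha hac (compl_compl a).ge
  · refine ha (mem_of_not_le fun c hc hca => not_le hb hc ?_)
    exact hba.trans ((compl_compl a).le.trans (le_compl_comm.1 hca))

end Pocset

namespace AISet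

variable {A B : AISet G} {ι : Type*} {X : ι → AISet G} {w : Set (AISet G)}

instance : Pocset (AISet G) where
  compl_compl A := AISet.ext (compl_compl (A : Set G))
  compl_le_compl := compl_le_compl
  not_le_compl A h := A.not_almostSubset_compl h.1

theorem smul_eq_self {g : G} (hg : g ∈ A.stab) : g • A = A :=
  AISet.ext hg

theorem hfinite_iUnion_sdiff_smul (hG : Group.FG G) (hA : A.stab.FG) (hB : B.stab.FG) :
    HFinite A.stab (⋃ (g : G) (_ : A ≤ g • B), (A : Set G) \ (g • B : AISet G)) := by
  obtain ⟨F, hF, hnested⟩ := exists_finite_nested hG hA hB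
    A.nontrivial.hfinite_preimage_symmDiff B.nontrivial.hfinite_preimage_symmDiff
  have hfin : HFinite A.stab
      (⋃ c ∈ {c ∈ F | A ≤ c • B}, (A.stab : Set G) * ((A : Set G) \ (c • B : AISet G))) :=
    HFinite.biUnion (hF.subset (Set.sep_subset _ _)) fun c hc => hc.2.1.coe_mul
  refine hfin.mono (Set.iUnion₂_subset fun g hg x hx => ?_)
  by_cases hgF : g ∈ (A.stab : Set G) * F * B.stab
  swap
  · exact absurd (subset_of_le_of_nested hg (hnested g hgF) hx.1) hx.2
  obtain ⟨_, ⟨h, hh, c, hc, rfl⟩, l, hl, rfl⟩ := hgF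
  have hgB : (h * c * l) • B = h • c • B := by
    rw [mul_smul, smul_eq_self hl, mul_smul]
  have hhA : h⁻¹ • A = A := smul_eq_self (inv_mem hh)
  rw [hgB] at hg hx
  have hcB : A ≤ c • B := by simpa only [hhA, inv_smul_smul] using smul_le_smul hg h⁻¹
  refine Set.mem_biUnion ⟨hc, hcB⟩ ⟨h, hh, h⁻¹ * x, ⟨?_, ?_⟩, mul_inv_cancel_left h x⟩
  · exact (mul_mem_iff_of_mem_stabilizer (inv_mem hh)).2 hx.1
  · exact fun h => hx.2 (Set.mem_smul_set_iff_inv_smul_mem.2 h)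

/-- The set `E(X)` of the translates of the members of the family `X` and of their complements. -/
def translates (X : ι → AISet G) : Set (AISet G) :=
  {A | ∃ (i : ι) (g : G), A = g • X i ∨ A = (g • X i)ᶜ}

theorem smul_mem_translates (hA : A ∈ translates X) (g : G) : g • A ∈ translates X := by
  obtain ⟨i, k, rfl | rfl⟩ := hA
  · exact ⟨i, g * k, Or.inl (mul_smul g k _).symm⟩
  · exact ⟨i, g * k, Or.inr (by rw [smul_compl, mul_smul])⟩

theorem compl_mem_translates (hA : A ∈ translates X) : Aᶜ ∈ translates X := by
  obtain ⟨i, k, rfl | rfl⟩ := hA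
  · exact ⟨i, k, Or.inr rfl⟩
  · exact ⟨i, k, Or.inl (Pocset.compl_compl _)⟩

theorem fg_stab_of_mem_translates (hX : ∀ i, (X i).stab.FG) (hA : A ∈ translates X) :
    A.stab.FG := by
  obtain ⟨i, g, rfl | rfl⟩ := hA
  · exact stab_smul g (X i) ▸ fg_conj_smul (hX i) g
  · exact stab_compl (g • X i) ▸ stab_smul g (X i) ▸ fg_conj_smul (hX i) g

theorem hfinite_iUnion_sdiff_translates [Finite ι] (hG : Group.FG G) (hX : ∀ i, (X i).stab.FG)
    (hA : A.stab.FG) :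
    HFinite A.stab (⋃ B ∈ {B ∈ translates X | A ≤ B}, (A : Set G) \ B) := by
  have hfin (i : ι) : HFinite A.stab
      ((⋃ (g : G) (_ : A ≤ g • X i), (A : Set G) \ (g • X i : AISet G)) ∪
        ⋃ (g : G) (_ : A ≤ g • (X i)ᶜ), (A : Set G) \ (g • (X i)ᶜ : AISet G)) :=
    (hfinite_iUnion_sdiff_smul hG hA (hX i)).union
      (hfinite_iUnion_sdiff_smul hG hA (stab_compl (X i) ▸ hX i))
  refine (HFinite.biUnion Set.finite_univ fun i _ => hfin i).mono ?_
  rintro x hx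
  obtain ⟨B, ⟨⟨i, g, hB⟩, hAB⟩, hx⟩ := Set.mem_iUnion₂.1 hx
  refine Set.mem_biUnion (Set.mem_univ i) (hB.imp ?_ ?_) <;> rintro rfl
  · exact Set.mem_iUnion₂.2 ⟨g, hAB, hx⟩
  · exact Set.mem_iUnion₂.2 ⟨g, smul_compl g (X i) ▸ hAB, smul_compl g (X i) ▸ hx⟩

/-- The set of those `g` for which the translate `g • w` of `w` contains `A`. With `w` an
ultrafilter, this is the set replacing `A`. -/
def orbitSet (w : Set (AISet G)) (A : AISet G) : Set G := {g | g⁻¹ • A ∈ w}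

theorem orbitSet_smul (w : Set (AISet G)) (g : G) (A : AISet G) :
    orbitSet w (g • A) = g • orbitSet w A := by
  ext x
  simp [orbitSet, Set.mem_smul_set_iff_inv_smul_mem, smul_smul]

theorem orbitSet_compl (hw : Pocset.IsUltrafilter w) (A : AISet G) :
    orbitSet w Aᶜ = (orbitSet w A)ᶜ := by
  ext x
  rw [orbitSet, Set.mem_ofPred_eq, smul_compl, hw.compl_mem_iff]
  rfl

theorem orbitSet_mono (hw : Pocset.IsUltrafilter w) (hAB : A ≤ B) :
    orbitSet w A ⊆ orbitSet w B :=
  fun g hg => hw.isUpperSet (smul_le_smul hAB g⁻¹) hg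

theorem stab_le_stabilizer_orbitSet (w : Set (AISet G)) (A : AISet G) :
    A.stab ≤ stabilizer G (orbitSet w A) := fun k hk => by
  rw [MulAction.mem_stabilizer_iff, ← orbitSet_smul, smul_eq_self hk]

/-- The ultrafilter contains every translate that contains `1`, except for those lying below the
complement of another such translate. -/
theorem exists_isUltrafilter_hfinite_symmDiff_orbitSet [Finite ι] (hG : Group.FG G)
    (hX : ∀ i, (X i).stab.FG) :
    ∃ w, Pocset.IsUltrafilter w ∧
      ∀ A ∈ translates X, HFinite A.stab ((A : Set G) ∆ orbitSet w A) := by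
  let P : Set (AISet G) := {A ∈ translates X | 1 ∈ (A : Set G)}
  obtain ⟨w, hw, hPw⟩ := Pocset.exists_isUltrafilter (s := {A ∈ P | ∀ B ∈ P, ¬ A ≤ Bᶜ})
    fun A hA B hB => hA.2 B hB.1
  have hfin {A : AISet G} (hA : A ∈ translates X) :
      HFinite A.stab ((A : Set G) \ orbitSet w A) := by
    refine (hfinite_iUnion_sdiff_translates hG hX (fg_stab_of_mem_translates hX hA)).mono ?_
    rintro g ⟨hgA, hgw⟩
    have hgP : g⁻¹ • A ∈ P := by
      refine ⟨smul_mem_translates hA g⁻¹, ?_⟩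
      simpa [coe_smul, Set.mem_smul_set_iff_inv_smul_mem] using hgA
    obtain ⟨B, hB, hle⟩ : ∃ B ∈ P, g⁻¹ • A ≤ Bᶜ := by
      by_contra! h
      exact hgw (hPw ⟨hgP, h⟩)
    have hAB : A ≤ g • Bᶜ := by simpa only [smul_inv_smul] using smul_le_smul hle g
    refine Set.mem_biUnion ⟨smul_mem_translates (compl_mem_translates hB.1) g, hAB⟩ ⟨hgA, ?_⟩
    simpa [coe_smul, coe_compl, Set.mem_smul_set_iff_inv_smul_mem] using hB.2
  refine ⟨w, hw, fun A hA => (hfin hA).union ?_⟩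
  rw [← compl_sdiff_compl, ← orbitSet_compl hw, ← coe_compl, ← stab_compl]
  exact hfin (compl_mem_translates hA)

theorem almostSubset_of_hfinite_orbitSet_sdiff (hA : HFinite A.stab ((A : Set G) ∆ orbitSet w A))
    (hB : HFinite B.stab ((B : Set G) ∆ orbitSet w B))
    (h : HFinite A.stab (orbitSet w A \ orbitSet w B)) : A.AlmostSubset B := by
  have hwA := A.nontrivial.of_hfinite_symmDiff (stab_le_stabilizer_orbitSet w A) hA
  have hwB := B.nontrivial.of_hfinite_symmDiff (stab_le_stabilizer_orbitSet w B) hB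
  have hAwB := A.nontrivial.hfinite_sdiff_trans hwA (hA.mono Set.subset_union_left) h
  exact A.nontrivial.hfinite_sdiff_trans hwB hAwB (hB.mono Set.subset_union_right)

theorem nested_orbitSet_of_hfinite_sdiff (hw : Pocset.IsUltrafilter w)
    (hA : HFinite A.stab ((A : Set G) ∆ orbitSet w A))
    (hB : HFinite B.stab ((B : Set G) ∆ orbitSet w B))
    (h : HFinite A.stab (orbitSet w A \ orbitSet w B)) :
    Nested (orbitSet w A) (orbitSet w B) := by
  rcases le_or_ge_of_almostSubset (almostSubset_of_hfinite_orbitSet_sdiff hA hB h) with hAB | hBA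
  · exact Or.inr (Or.inr (Or.inl (Set.sdiff_eq_empty.2 (orbitSet_mono hw hAB))))
  · rw [nested_comm]
    exact Or.inr (Or.inr (Or.inl (Set.sdiff_eq_empty.2 (orbitSet_mono hw hBA))))

theorem crosses_or_nested_orbitSet (hw : Pocset.IsUltrafilter w)
    (hfin : ∀ A ∈ translates X, HFinite A.stab ((A : Set G) ∆ orbitSet w A))
    (hA : A ∈ translates X) (hB : B ∈ translates X) :
    Crosses A.stab (orbitSet w A) (orbitSet w B) ∨ Nested (orbitSet w A) (orbitSet w B) := by
  have nested {A B : AISet G} (hA : A ∈ translates X) (hB : B ∈ translates X)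
      (h : HFinite A.stab (orbitSet w A ∩ (orbitSet w B)ᶜ)) :
      Nested (orbitSet w A) (orbitSet w B) :=
    nested_orbitSet_of_hfinite_sdiff hw (hfin A hA) (hfin B hB) h
  have hA' := compl_mem_translates hA
  have hB' := compl_mem_translates hB
  refine or_iff_not_imp_right.2 fun hn => ⟨fun h => hn ?_, fun h => hn ?_, fun h => hn ?_,
    fun h => hn ?_⟩
  · rw [← nested_compl_right, ← orbitSet_compl hw]
    exact nested hA hB' (by rwa [orbitSet_compl hw, compl_compl])
  · rw [← nested_compl_left, ← nested_compl_right, ← orbitSet_compl hw, ← orbitSet_compl hw]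
    exact nested hA' hB' (by rwa [orbitSet_compl hw, orbitSet_compl hw, compl_compl, stab_compl])
  · exact nested hA hB h
  · rw [← nested_compl_left, ← orbitSet_compl hw]
    exact nested hA' hB (by rwa [orbitSet_compl hw, stab_compl])

end AISet

section VeryGoodPosition

variable {ι : Type*} {H K : ι → Subgroup G} {L M : Subgroup G} {U V : Set G} {Z : ι → Set G}

theorem VeryGoodPosition.almostLE_iff_subset (h : VeryGoodPosition K Z) (hU : MemE K Z L U)
    (hV : MemE K Z M V) : AlmostLE L U V ↔ U ⊆ V := by
  rw [← Set.sdiff_eq_empty, Set.sdiff_eq]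
  refine ⟨?_, Or.inl⟩
  have hfinite_of_eq_empty {A : Set G} (hA : A = ∅) : HFinite L A := hA ▸ HFinite.empty
  rintro (hempty | ⟨hfin, h₁, h₂, h₃⟩)
  · exact hempty
  rcases h L M U V hU hV with hcross | hn | hn | hn | hn
  · exact absurd hfin hcross.2.2.1
  · exact absurd (hfinite_of_eq_empty hn) h₁
  · exact absurd (hfinite_of_eq_empty hn) h₂
  · exact hn
  · exact absurd (hfinite_of_eq_empty hn) h₃

theorem exists_mem_translates_of_memE {Y : ι → AISet G} {w : Set (AISet G)}
    (hw : Pocset.IsUltrafilter w) (hH : ∀ i, IsNontrivialAlmostInvariant (H i) (Y i : Set G))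
    (hU : MemE H (fun i => AISet.orbitSet w (Y i)) L U) :
    ∃ A ∈ AISet.translates Y, U = AISet.orbitSet w A ∧
      ∀ W, HFinite L W ↔ HFinite A.stab W := by
  obtain ⟨i, g, rfl, hU⟩ := hU
  have hfin (W : Set G) : HFinite (MulAut.conj g • H i) W ↔ HFinite (g • Y i).stab W :=
    ((hH i).conj_smul g).hfinite_iff_hfinite_stabilizer
  rcases hU with rfl | rfl
  · exact ⟨g • Y i, ⟨i, g, Or.inl rfl⟩, (AISet.orbitSet_smul w g (Y i)).symm, hfin⟩
  · refine ⟨(g • Y i)ᶜ, ⟨i, g, Or.inr rfl⟩, ?_, by rwa [AISet.stab_compl]⟩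
    rw [AISet.orbitSet_compl hw, AISet.orbitSet_smul]

theorem veryGoodPosition_orbitSet {Y : ι → AISet G} {w : Set (AISet G)}
    (hw : Pocset.IsUltrafilter w) (hH : ∀ i, IsNontrivialAlmostInvariant (H i) (Y i : Set G))
    (hfin : ∀ A ∈ AISet.translates Y, HFinite A.stab ((A : Set G) ∆ AISet.orbitSet w A)) :
    VeryGoodPosition H fun i => AISet.orbitSet w (Y i) := by
  intro L M U V hU hV
  obtain ⟨A, hA, rfl, hLA⟩ := exists_mem_translates_of_memE hw hH hU
  obtain ⟨B, hB, rfl, -⟩ := exists_mem_translates_of_memE hw hH hV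
  simpa only [Crosses, hLA] using AISet.crosses_or_nested_orbitSet hw hfin hA hB

theorem mainTheorem2_general [Finite ι] (hG : Group.FG G) (H : ι → Subgroup G)
    (hH : ∀ i, (H i).FG) (X : ι → Set G) (hX : ∀ i, IsNontrivialAlmostInvariant (H i) (X i)) :
    ∃ Z : ι → Set G,
      (∀ i, IsNontrivialAlmostInvariant (H i) (Z i)) ∧
      (∀ i, Equivalent (H i) (X i) (H i) (Z i)) ∧
      VeryGoodPosition H Z := by
  let Y (i : ι) : AISet G := ⟨X i, (hX i).stabilizer⟩
  have fg_stab (i : ι) : (Y i).stab.FG :=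
    fg_of_hfinite (hH i) (hX i).le_stabilizer
      ((hX i).hfinite_iff_hfinite_stabilizer.2 (HFinite.refl _))
  obtain ⟨w, hw, hfin⟩ := AISet.exists_isUltrafilter_hfinite_symmDiff_orbitSet hG fg_stab
  have hXZ (i : ι) : HFinite (H i) (X i ∆ AISet.orbitSet w (Y i)) :=
    (hX i).hfinite_iff_hfinite_stabilizer.2
      (hfin (Y i) ⟨i, 1, Or.inl (one_smul G (Y i)).symm⟩)
  have hZ (i : ι) : IsNontrivialAlmostInvariant (H i) (AISet.orbitSet w (Y i)) :=
    (hX i).of_hfinite_symmDiff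
      ((hX i).le_stabilizer.trans (AISet.stab_le_stabilizer_orbitSet w (Y i))) (hXZ i)
  exact ⟨fun i => AISet.orbitSet w (Y i), hZ, fun i => ⟨(hX i).1, (hZ i).1, hXZ i⟩,
    veryGoodPosition_orbitSet hw hX hfin⟩

end VeryGoodPosition

end AlmostInv

theorem mainTheorem2 {G : Type*} [Group G] (hG : Group.FG G) (n : ℕ)
    (H : Fin n → Subgroup G) (hH : ∀ i, (H i).FG)
    (X : Fin n → Set G) (hX : ∀ i, AlmostInv.IsNontrivialAlmostInvariant (H i) (X i)) :
    ∃ (K : Fin n → Subgroup G) (Z : Fin n → Set G),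
      (∀ i, AlmostInv.IsNontrivialAlmostInvariant (K i) (Z i)) ∧
      (∀ i, AlmostInv.Equivalent (H i) (X i) (K i) (Z i)) ∧
      AlmostInv.VeryGoodPosition K Z ∧
      (∀ (L M : Subgroup G) (U V : Set G),
        AlmostInv.MemE K Z L U → AlmostInv.MemE K Z M V →
          (AlmostInv.AlmostLE L U V ↔ U ⊆ V)) := by
  obtain ⟨Z, hZ, hXZ, hpos⟩ := AlmostInv.mainTheorem2_general hG H hH X hX
  exact ⟨H, Z, hZ, hXZ, hpos, fun L M U V => hpos.almostLE_iff_subset⟩
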